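/- **Theorem (Universality).** Fix a countably infinite set of qubit variables. An environment $\Gamma$ is a finite set of variables, with state space $\mathcal H_\Gamma=\bigotimes_{q\in\Gamma}\mathbb C^2$; write $q,\Gamma$ for $\{q\}\cup\Gamma$ when $q\notin\Gamma$. Statements are generated by $$S::=\mathbf{skip}\mid\mathbf{new\ qbit}\ q\mid\mathbf{discard}\ q\mid q\mathbin{*{=}}U\mid S_0;S_1\mid\mathbf{meas}\ q\,(0\to S_0,1\to S_1)\mid\mathbf{while}\ q\ \mathbf{do}\ S\mid\mathbf{qcase}\ q\,(0\to S_0,1\to S_1),$$ where $U$ is any $2\times2$ unitary matrix. The judgment $\Gamma\vdash S\triangleright\Delta$ (in words: $(\Gamma;S;\Delta)$ is a program) is defined inductively by: - $\Gamma\vdash\mathbf{skip}\triangleright\Gamma$; $\ \Gamma\vdash\mathbf{new\ qbit}\ q\triangleright q,\Gamma$; $\ q,\Gamma\vdash\mathbf{discard}\ q\triangleright\Gamma$; $\ q,\Gamma\vdash q\mathbin{*{=}}U\triangleright q,\Gamma$; - if $\Gamma\vdash S_0\triangleright\Gamma'$ and $\Gamma'\vdash S_1\triangleright\Gamma''$,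 then $\Gamma\vdash S_0;S_1\triangleright\Gamma''$; - if $q,\Gamma\vdash S_i\triangleright\Gamma'$ for $i=0,1$, then $q,\Gamma\vdash\mathbf{meas}\ q\,(0\to S_0,1\to S_1)\triangleright\Gamma'$; - if $q,\Gamma\vdash S\triangleright q,\Gamma$, then $q,\Gamma\vdash\mathbf{while}\ q\ \mathbf{do}\ S\triangleright q,\Gamma$; - if $\Gamma\vdash S_i\triangleright\Gamma'$ for $i=0,1$ and $q$ does not appear in $S_0$ or $S_1$, then $q,\Gamma\vdash\mathbf{qcase}\ q\,(0\to S_0,1\to S_1)\triangleright q,\Gamma'$. A quantum operation is a completely positive, trace non-increasing linear map $\mathcal L(\mathcal H_A)\to\mathcal L(\mathcal H_B)$. Let $\mathcal K_{\Gamma;\Delta}$ be the set of pairs $(\mathcal C,F)$, where $\mathcal C$ is a quantum operation from $\mathcal H_\Gamma$ to $\mathcal H_\Delta$ and $F:\mathcal H_\Gamma\to\mathcal H_\Delta$ is linear, such that the map $$\tilde{\mathcal C}^F:\begin{bmatrix}A&B\\ C&D\end{bmatrix}\mapsto\begin{bmatrix}\mathcal C(A)&FB\\ CF^\dagger&D\end{bmatrix}$$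 is a quantum operation from $\mathcal H_\Gamma\oplus\mathbb C$ to $\mathcal H_\Delta\oplus\mathbb C$ (the summand $\mathbb C$ is the vacuum; $\tilde{\mathcal C}^F$ is a vacuum extension of $\mathcal C$ that is trace preserving on the vacuum). Order $\mathcal K_{\Gamma;\Delta}$ by $(\mathcal C,F)\le(\mathcal D,G)$ iff $(\tilde{\mathcal D}^G\otimes\mathcal I_E)(\rho)-(\tilde{\mathcal C}^F\otimes\mathcal I_E)(\rho)$ is positive semidefinite for every finite-dimensional $\mathcal H_E$ and every density matrix $\rho$ (positive semidefinite, trace at most $1$). Let $(\mathcal D,G)\circ(\mathcal C,F)=(\mathcal D\circ\mathcal C,GF)$. The interpretation $[\![S]\!]_\Gamma$ of a program $(\Gamma;S;\Delta)$ is defined by recursion. Here $\mathcal P_k(\rho)=|k\rangle\langle k|_q\,\rho\,|k\rangle\langle k|_q$, and $U_q$ is $U$ on the qubit $q$ and the identity elsewhere. - $[\![\mathbf{skip}]\!]_\Gamma=(\mathcal I_\Gamma,I_\Gamma)$; $\ [\![\mathbf{new\ qbit}\ q]\!]_\Gamma=(|0\rangle\langle0|_q\otimes\mathcal I_\Gamma,\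 |0\rangle_q\otimes I_\Gamma)$; $\ [\![\mathbf{discard}\ q]\!]_{q,\Gamma}=(\mathrm{Tr}_q,\ \langle0|_q\otimes I_\Gamma)$; $\ [\![q\mathbin{*{=}}U]\!]_{q,\Gamma}=(U_q(\cdot)U_q^\dagger,\ U_q)$; - $[\![S_0;S_1]\!]_\Gamma=[\![S_1]\!]_{\Gamma'}\circ[\![S_0]\!]_\Gamma$, where $\Gamma\vdash S_0\triangleright\Gamma'$; - $[\![\mathbf{meas}\ q\,(0\to S_0,1\to S_1)]\!]_{q,\Gamma}=\overline{\mathbf{meas}}_q\bigl[[\![S_0]\!]_{q,\Gamma},[\![S_1]\!]_{q,\Gamma}\bigr]$, where $\overline{\mathbf{meas}}_q[(\mathcal C_0,F_0),(\mathcal C_1,F_1)]=(\mathcal C_0\circ\mathcal P_0+\mathcal C_1\circ\mathcal P_1,\ F_0|0\rangle\langle0|_q)$; - $[\![\mathbf{while}\ q\ \mathbf{do}\ S]\!]_{q,\Gamma}$ is the least fixed point in $\mathcal K_{q,\Gamma;q,\Gamma}$ of $p\mapsto\overline{\mathbf{meas}}_q\bigl[(\mathcal I_{q,\Gamma},I_{q,\Gamma}),\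 p\circ[\![S]\!]_{q,\Gamma}\bigr]$; - if $[\![S_i]\!]_\Gamma=(\mathcal C_i,F_i)$ for $i=0,1$, then, writing the control qubit $q$ first, $$[\![\mathbf{qcase}\ q\,(0\to S_0,1\to S_1)]\!]_{q,\Gamma}=\left(\begin{bmatrix}A&B\\ C&D\end{bmatrix}\mapsto\begin{bmatrix}\mathcal C_0(A)&F_0BF_1^\dagger\\ F_1CF_0^\dagger&\mathcal C_1(D)\end{bmatrix},\ \begin{bmatrix}F_0&0\\0&F_1\end{bmatrix}\right).$$ Then for all environments $\Gamma,\Delta$ and every $(\mathcal C,F)\in\mathcal K_{\Gamma;\Delta}$ there is a statement $S$ with $\Gamma\vdash S\triangleright\Delta$ and $[\![S]\!]_\Gamma=(\mathcal C,F)$. -/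

import Mathlib

open scoped ComplexOrder

namespace QLang

noncomputable section

/-! ### Quantum operations between matrix algebras

A finite-dimensional Hilbert space is given by the finite index type of an orthonormal basis. -/

/-- `𝒞 ⊗ ℐ_E` for an auxiliary system `E` of dimension `k`. -/
def ampliate {n m : Type*} (C : Matrix n n ℂ →ₗ[ℂ] Matrix m m ℂ) (k : ℕ)
    (ρ : Matrix (n × Fin k) (n × Fin k) ℂ) : Matrix (m × Fin k) (m × Fin k) ℂ :=
  Matrix.of fun i j => C (Matrix.of fun a b => ρ (a, i.2) (b, j.2)) i.1 j.1

/-- Quantum operations: completely positive, trace non-increasing linear maps. -/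
structure IsQuantumOperation {n m : Type*} [Fintype n] [Fintype m]
    (C : Matrix n n ℂ →ₗ[ℂ] Matrix m m ℂ) : Prop where
  completelyPositive : ∀ (k : ℕ) (ρ : Matrix (n × Fin k) (n × Fin k) ℂ),
    ρ.PosSemidef → (ampliate C k ρ).PosSemidef
  trace_le : ∀ ρ : Matrix n n ℂ, ρ.PosSemidef → (C ρ).trace ≤ ρ.trace

/-- The map `ρ ↦ A ρ B†`. -/
def sandwich {n m : Type*} [Fintype n] [Fintype m] (A B : Matrix m n ℂ) :
    Matrix n n ℂ →ₗ[ℂ] Matrix m m ℂ where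
  toFun ρ := A * ρ * B.conjTranspose
  map_add' ρ σ := by rw [Matrix.mul_add, Matrix.add_mul]
  map_smul' c ρ := by rw [Matrix.mul_smul, Matrix.smul_mul, RingHom.id_apply]

/-- Density matrices: positive semidefinite of trace at most one. -/
def IsDensity {n : Type*} [Fintype n] (ρ : Matrix n n ℂ) : Prop :=
  ρ.PosSemidef ∧ ρ.trace ≤ 1

/-- The Löwner ordering on quantum operations. -/
def LoewnerLE {n m : Type*} [Fintype n] [Fintype m]
    (C D : Matrix n n ℂ →ₗ[ℂ] Matrix m m ℂ) : Prop :=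
  ∀ (k : ℕ) (ρ : Matrix (n × Fin k) (n × Fin k) ℂ), IsDensity ρ →
    (ampliate D k ρ - ampliate C k ρ).PosSemidef

/-! ### Vacuum extensions -/

/-- Pairs `(𝒞, F)` of a linear map on operators and a transformation matrix. -/
abbrev VPair (n m : Type*) : Type _ :=
  (Matrix n n ℂ →ₗ[ℂ] Matrix m m ℂ) × Matrix m n ℂ

/-- The vacuum extension of `(𝒞, F)` acting on `ℋ ⊕ Vac`, with `Vac` spanned by the basis vector
`Sum.inr ()`. In block form it sends `[A, B; C, D]` to `[𝒞 A, F B; C F†, D]`. -/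
def vacExt {n m : Type*} [Fintype n] (p : VPair n m) :
    Matrix (n ⊕ Unit) (n ⊕ Unit) ℂ →ₗ[ℂ] Matrix (m ⊕ Unit) (m ⊕ Unit) ℂ where
  toFun ρ := Matrix.fromBlocks (p.1 ρ.toBlocks₁₁) (p.2 * ρ.toBlocks₁₂)
    (ρ.toBlocks₂₁ * p.2.conjTranspose) ρ.toBlocks₂₂
  map_add' ρ σ := by
    have h₁₁ : (ρ + σ).toBlocks₁₁ = ρ.toBlocks₁₁ + σ.toBlocks₁₁ := rfl
    have h₁₂ : (ρ + σ).toBlocks₁₂ = ρ.toBlocks₁₂ + σ.toBlocks₁₂ := rfl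
    have h₂₁ : (ρ + σ).toBlocks₂₁ = ρ.toBlocks₂₁ + σ.toBlocks₂₁ := rfl
    have h₂₂ : (ρ + σ).toBlocks₂₂ = ρ.toBlocks₂₂ + σ.toBlocks₂₂ := rfl
    rw [h₁₁, h₁₂, h₂₁, h₂₂, Matrix.fromBlocks_add, map_add, Matrix.mul_add, Matrix.add_mul]
  map_smul' c ρ := by
    have h₁₁ : (c • ρ).toBlocks₁₁ = c • ρ.toBlocks₁₁ := rfl
    have h₁₂ : (c • ρ).toBlocks₁₂ = c • ρ.toBlocks₁₂ := rfl
    have h₂₁ : (c • ρ).toBlocks₂₁ = c • ρ.toBlocks₂₁ := rfl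
    have h₂₂ : (c • ρ).toBlocks₂₂ = c • ρ.toBlocks₂₂ := rfl
    rw [h₁₁, h₁₂, h₂₁, h₂₂, RingHom.id_apply, Matrix.fromBlocks_smul, map_smul,
      Matrix.mul_smul, Matrix.smul_mul]

/-- The set `𝒦` of vacuum-extended operations that are trace preserving on the vacuum. -/
def vacOps (n m : Type*) [Fintype n] [Fintype m] : Set (VPair n m) :=
  {p | IsQuantumOperation p.1 ∧ IsQuantumOperation (vacExt p)}

/-- Composition `(𝒟, G) ∘ (𝒞, F) = (𝒟 ∘ 𝒞, G F)`. -/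
def VPair.comp {l m n : Type*} [Fintype m] (q : VPair m l) (p : VPair n m) : VPair n l :=
  (q.1 ∘ₗ p.1, q.2 * p.2)

/-- The ordering on `𝒦`: the Löwner ordering of the vacuum extensions. -/
def VPair.LE {n m : Type*} [Fintype n] [Fintype m] (p q : VPair n m) : Prop :=
  LoewnerLE (vacExt p) (vacExt q)

/-- `p` is the least fixed point of `Φ` in `𝒦`. -/
def IsLeastFixedPoint {n m : Type*} [Fintype n] [Fintype m]
    (Φ : VPair n m → VPair n m) (p : VPair n m) : Prop :=
  (p ∈ vacOps n m ∧ Φ p = p) ∧ ∀ p' ∈ vacOps n m, Φ p' = p' → VPair.LE p p'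

open Classical in
/-- The least fixed point of `Φ` in `𝒦` (and `0` if there is none). -/
def lfp {n m : Type*} [Fintype n] [Fintype m] (Φ : VPair n m → VPair n m) : VPair n m :=
  if h : ∃ p, IsLeastFixedPoint Φ p then h.choose else 0

/-! ### Syntax and well-formedness -/

/-- Statements over a set `X` of qubit variables. -/
inductive Stmt (X : Type*) : Type _
  | skip : Stmt X
  | newQbit (q : X) : Stmt X
  | discard (q : X) : Stmt X
  | gate (q : X) (U : Matrix.unitaryGroup (Fin 2) ℂ) : Stmt X
  | seq (S₀ S₁ : Stmt X) : Stmt X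
  | meas (q : X) (S₀ S₁ : Stmt X) : Stmt X
  | whileDo (q : X) (S : Stmt X) : Stmt X
  | qcase (q : X) (S₀ S₁ : Stmt X) : Stmt X

/-- The variables appearing in a statement. -/
def Stmt.vars {X : Type*} [DecidableEq X] : Stmt X → Finset X
  | .skip => ∅
  | .newQbit q => {q}
  | .discard q => {q}
  | .gate q _ => {q}
  | .seq S₀ S₁ => S₀.vars ∪ S₁.vars
  | .meas q S₀ S₁ => insert q (S₀.vars ∪ S₁.vars)
  | .whileDo q S => insert q S.vars
  | .qcase q S₀ S₁ => insert q (S₀.vars ∪ S₁.vars)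

/-- Derivations of the judgment `Γ ⊢ S ▷ Δ`. An environment is a finite set of variables, and
`insert q Γ` with `q ∉ Γ` is the extension `q, Γ`. -/
inductive Derivation {X : Type*} [DecidableEq X] : Finset X → Stmt X → Finset X → Type _
  | skip (Γ : Finset X) : Derivation Γ .skip Γ
  | newQbit (q : X) (Γ : Finset X) (hq : q ∉ Γ) : Derivation Γ (.newQbit q) (insert q Γ)
  | discard (q : X) (Γ : Finset X) (hq : q ∉ Γ) : Derivation (insert q Γ) (.discard q) Γ
  | gate (q : X) (U : Matrix.unitaryGroup (Fin 2) ℂ) (Γ : Finset X) (hq : q ∈ Γ) :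
      Derivation Γ (.gate q U) Γ
  | seq {Γ Γ' Γ'' : Finset X} {S₀ S₁ : Stmt X} (d₀ : Derivation Γ S₀ Γ')
      (d₁ : Derivation Γ' S₁ Γ'') : Derivation Γ (.seq S₀ S₁) Γ''
  | meas (q : X) {Γ Γ' : Finset X} {S₀ S₁ : Stmt X} (hq : q ∈ Γ) (d₀ : Derivation Γ S₀ Γ')
      (d₁ : Derivation Γ S₁ Γ') : Derivation Γ (.meas q S₀ S₁) Γ'
  | whileDo (q : X) {Γ : Finset X} {S : Stmt X} (hq : q ∈ Γ) (d : Derivation Γ S Γ) :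
      Derivation Γ (.whileDo q S) Γ
  | qcase (q : X) {Γ Γ' : Finset X} {S₀ S₁ : Stmt X} (hq : q ∉ Γ) (hq' : q ∉ Γ')
      (hS : q ∉ S₀.vars ∪ S₁.vars) (d₀ : Derivation Γ S₀ Γ') (d₁ : Derivation Γ S₁ Γ') :
      Derivation (insert q Γ) (.qcase q S₀ S₁) (insert q Γ')

/-- `(Γ; S; Δ)` is a (well-formed) program if `Γ ⊢ S ▷ Δ` is derivable. -/
def IsProgram {X : Type*} [DecidableEq X] (Γ : Finset X) (S : Stmt X) (Δ : Finset X) : Prop :=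
  Nonempty (Derivation Γ S Δ)

/-! ### State spaces and basic operators -/

/-- The computational basis of `ℋ_Γ`: one bit for every variable of `Γ`. -/
abbrev Conf {X : Type*} (Γ : Finset X) : Type _ := {x // x ∈ Γ} → Fin 2

/-- The operator `|k⟩_q ⊗ I_Γ` from `ℋ_Γ` to `ℋ_{q,Γ}`, where `q ∉ Γ`. -/
def ket {X : Type*} [DecidableEq X] (q : X) (Γ : Finset X) (k : Fin 2) :
    Matrix (Conf (insert q Γ)) (Conf Γ) ℂ :=
  fun b a =>
    if b ⟨q, Finset.mem_insert_self q Γ⟩ = k ∧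
        ∀ x : {x // x ∈ Γ}, b ⟨x.1, Finset.mem_insert_of_mem x.2⟩ = a x
    then 1 else 0

/-- The operator `⟨k|_q ⊗ I_Γ` from `ℋ_{q,Γ}` to `ℋ_Γ`, where `q ∉ Γ`. -/
def bra {X : Type*} [DecidableEq X] (q : X) (Γ : Finset X) (k : Fin 2) :
    Matrix (Conf Γ) (Conf (insert q Γ)) ℂ :=
  (ket q Γ k).conjTranspose

/-- The projector `|k⟩⟨k|_q` on `ℋ_Γ`, where `q ∈ Γ`. -/
def proj {X : Type*} [DecidableEq X] {q : X} {Γ : Finset X} (hq : q ∈ Γ) (k : Fin 2) :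
    Matrix (Conf Γ) (Conf Γ) ℂ :=
  Matrix.diagonal fun b => if b ⟨q, hq⟩ = k then 1 else 0

/-- The operator `U_q` on `ℋ_Γ`, where `q ∈ Γ`: `U` on the qubit `q` and the identity elsewhere. -/
def gateAt {X : Type*} [DecidableEq X] {q : X} {Γ : Finset X} (hq : q ∈ Γ)
    (U : Matrix (Fin 2) (Fin 2) ℂ) : Matrix (Conf Γ) (Conf Γ) ℂ :=
  fun b a => if ∀ x : {x // x ∈ Γ}, x.1 ≠ q → b x = a x then U (b ⟨q, hq⟩) (a ⟨q, hq⟩) else 0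

/-! ### Denotational semantics -/

/-- The semantic measurement operation `(𝒞₀ ∘ 𝒫₀ + 𝒞₁ ∘ 𝒫₁, F₀ |0⟩⟨0|_q)`. -/
def measOp {X : Type*} [DecidableEq X] {q : X} {Γ Γ' : Finset X} (hq : q ∈ Γ)
    (p₀ p₁ : VPair (Conf Γ) (Conf Γ')) : VPair (Conf Γ) (Conf Γ') :=
  (p₀.1 ∘ₗ sandwich (proj hq 0) (proj hq 0) + p₁.1 ∘ₗ sandwich (proj hq 1) (proj hq 1),
    p₀.2 * proj hq 0)

/-- The operator `|k⟩⟨k|_q ⊗ F`. -/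
def controlled {X : Type*} [DecidableEq X] (q : X) {Γ Γ' : Finset X} (k : Fin 2)
    (F : Matrix (Conf Γ') (Conf Γ) ℂ) : Matrix (Conf (insert q Γ')) (Conf (insert q Γ)) ℂ :=
  ket q Γ' k * F * bra q Γ k

/-- The semantic quantum case. With the control qubit first, its first component sends
`[A, B; C, D]` to `[𝒞₀ A, F₀ B F₁†; F₁ C F₀†, 𝒞₁ D]`. The composite
`sandwich (ket q Γ' k) (ket q Γ' k) ∘ₗ 𝒞 ∘ₗ sandwich (bra q Γ k) (bra q Γ k)` is `𝒫_k ⊗ 𝒞`. -/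
def qcaseOp {X : Type*} [DecidableEq X] (q : X) {Γ Γ' : Finset X}
    (p₀ p₁ : VPair (Conf Γ) (Conf Γ')) :
    VPair (Conf (insert q Γ)) (Conf (insert q Γ')) :=
  (sandwich (ket q Γ' 0) (ket q Γ' 0) ∘ₗ p₀.1 ∘ₗ sandwich (bra q Γ 0) (bra q Γ 0)
    + sandwich (ket q Γ' 1) (ket q Γ' 1) ∘ₗ p₁.1 ∘ₗ sandwich (bra q Γ 1) (bra q Γ 1)
    + sandwich (controlled q 0 p₀.2) (controlled q 1 p₁.2)
    + sandwich (controlled q 1 p₁.2) (controlled q 0 p₀.2),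
    controlled q 0 p₀.2 + controlled q 1 p₁.2)

/-- The denotational semantics, by recursion on the derivation. -/
def Derivation.sem {X : Type*} [DecidableEq X] {Γ Δ : Finset X} {S : Stmt X} :
    Derivation Γ S Δ → VPair (Conf Γ) (Conf Δ)
  | .skip _ => (LinearMap.id, 1)
  | .newQbit q Γ _ => (sandwich (ket q Γ 0) (ket q Γ 0), ket q Γ 0)
  | .discard q Γ _ =>
      (sandwich (bra q Γ 0) (bra q Γ 0) + sandwich (bra q Γ 1) (bra q Γ 1), bra q Γ 0)
  | .gate _ U _ hq =>
      (sandwich (gateAt hq (U : Matrix (Fin 2) (Fin 2) ℂ))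
        (gateAt hq (U : Matrix (Fin 2) (Fin 2) ℂ)), gateAt hq (U : Matrix (Fin 2) (Fin 2) ℂ))
  | .seq d₀ d₁ => d₁.sem.comp d₀.sem
  | .meas _ hq d₀ d₁ => measOp hq d₀.sem d₁.sem
  | .whileDo _ hq d => lfp fun p => measOp hq (LinearMap.id, 1) (p.comp d.sem)
  | .qcase q _ _ _ d₀ d₁ => qcaseOp q d₀.sem d₁.sem

/-- The interpretation `⟦S⟧_Γ` of a program `(Γ; S; Δ)`. -/
def sem {X : Type*} [DecidableEq X] {Γ Δ : Finset X} {S : Stmt X} (h : IsProgram Γ S Δ) :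
    VPair (Conf Γ) (Conf Δ) :=
  (Classical.choice h).sem

/-! The output environment and the derivation of a program are unique, so that `⟦S⟧_Γ` does not
depend on the choice of a derivation. -/

theorem insert_injective_of_notMem {X : Type*} [DecidableEq X] {q : X} {Γ Γ' : Finset X}
    (h : q ∉ Γ) (h' : q ∉ Γ') (e : insert q Γ = insert q Γ') : Γ = Γ' := by
  rw [← Finset.erase_insert h, e, Finset.erase_insert h']

theorem derivation_unique {X : Type*} [DecidableEq X] {Γ : Finset X} {S : Stmt X}
    {Δ : Finset X} (d : Derivation Γ S Δ) :
    ∀ {Γ₁ Δ₁ : Finset X} (d₁ : Derivation Γ₁ S Δ₁), Γ = Γ₁ → Δ = Δ₁ ∧ HEq d d₁ := by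
  induction d with
  | skip Γ => intro _ _ d₁ e; cases d₁; subst e; exact ⟨rfl, HEq.rfl⟩
  | newQbit q Γ hq => intro _ _ d₁ e; cases d₁; subst e; exact ⟨rfl, HEq.rfl⟩
  | discard q Γ hq =>
    intro _ _ d₁ e
    cases d₁ with
    | discard _ _ hq₁ =>
      obtain rfl := insert_injective_of_notMem hq hq₁ e
      exact ⟨rfl, HEq.rfl⟩
  | gate q U Γ hq => intro _ _ d₁ e; cases d₁; subst e; exact ⟨rfl, HEq.rfl⟩
  | seq a b iha ihb =>
    intro _ _ d₁ e
    cases d₁ with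
    | seq a₁ b₁ =>
      subst e
      obtain ⟨rfl, h⟩ := iha a₁ rfl
      obtain ⟨rfl, h'⟩ := ihb b₁ rfl
      obtain rfl := eq_of_heq h
      obtain rfl := eq_of_heq h'
      exact ⟨rfl, HEq.rfl⟩
  | meas q hq a b iha ihb =>
    intro _ _ d₁ e
    cases d₁ with
    | meas _ hq₁ a₁ b₁ =>
      subst e
      obtain ⟨rfl, h⟩ := iha a₁ rfl
      obtain ⟨_, h'⟩ := ihb b₁ rfl
      obtain rfl := eq_of_heq h
      obtain rfl := eq_of_heq h'
      exact ⟨rfl, HEq.rfl⟩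
  | whileDo q hq a iha =>
    intro _ _ d₁ e
    cases d₁ with
    | whileDo _ hq₁ a₁ =>
      subst e
      obtain ⟨_, h⟩ := iha a₁ rfl
      obtain rfl := eq_of_heq h
      exact ⟨rfl, HEq.rfl⟩
  | qcase q hq hq' hS a b iha ihb =>
    intro _ _ d₁ e
    cases d₁ with
    | qcase _ hq₁ hq₁' hS₁ a₁ b₁ =>
      obtain rfl := insert_injective_of_notMem hq hq₁ e
      obtain ⟨rfl, h⟩ := iha a₁ rfl
      obtain ⟨_, h'⟩ := ihb b₁ rfl
      obtain rfl := eq_of_heq h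
      obtain rfl := eq_of_heq h'
      exact ⟨rfl, HEq.rfl⟩

theorem sem_eq {X : Type*} [DecidableEq X] {Γ Δ : Finset X} {S : Stmt X}
    (h : IsProgram Γ S Δ) (d : Derivation Γ S Δ) : sem h = d.sem := by
  unfold sem
  rw [eq_of_heq (derivation_unique (Classical.choice h) d rfl).2]

end

end QLang

/-!
Positivity of the Choi matrix of `𝒞̃^F` gives, by a Schur complement with respect to the vacuum, a
Kraus decomposition `𝒞 = F · F† + ∑ᵢ Kᵢ · Kᵢ†`, and since `𝒞` does not increase the trace,
`F† F + ∑ᵢ Kᵢ† Kᵢ ≤ 1`.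

Conversely, any such pair is realized by discarding fresh qubits. As the `F`-component of
`discard q` is `⟨0|_q`, applying it to `|0⟩_q ⊗ F + |1⟩_q ⊗ Kⱼ` and `|0⟩_q ⊗ Kᵢ` (`i ≠ j`) adds the
operator `Kⱼ` to the Kraus family and keeps `F`. This reduces the claim to pairs `(F · F†, F)` with
`F† F ≤ 1`. Such an `F` is a compression of a unitary: add a qubit in state `|0⟩`, apply the unitary
and project that qubit onto `|0⟩`. The projection is `while q do skip`, whose iterates lose the
component `|1⟩_q`.

All unitaries on a nonempty register are products of one-qubit gates and quantum cases: they are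
products of complex Householder transformations, each of which is conjugate, through a circuit for
state preparation, to a phase on the basis vector `|0…0⟩`. That phase is a nested quantum case
around a one-qubit gate, so global phases and controls need no separate treatment.
-/

namespace QLang

open Matrix
open scoped MatrixOrder

section Operations

variable {l m n : Type*}

/-- Complete positivity, tested on ancillas of every finite dimension. -/
def IsCompletelyPositive [Fintype m] [Fintype n] (C : Matrix n n ℂ →ₗ[ℂ] Matrix m m ℂ) : Prop :=
  ∀ (k : ℕ) (ρ : Matrix (n × Fin k) (n × Fin k) ℂ), ρ.PosSemidef → (ampliate C k ρ).PosSemidef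

variable [Fintype l] [Fintype m] [Fintype n]

theorem IsCompletelyPositive.comp {D : Matrix m m ℂ →ₗ[ℂ] Matrix l l ℂ}
    {C : Matrix n n ℂ →ₗ[ℂ] Matrix m m ℂ} (hD : IsCompletelyPositive D)
    (hC : IsCompletelyPositive C) : IsCompletelyPositive (D ∘ₗ C) :=
  fun k ρ hρ => hD k _ (hC k ρ hρ)

theorem sandwich_apply (A B : Matrix m n ℂ) (ρ : Matrix n n ℂ) : sandwich A B ρ = A * ρ * Bᴴ :=
  rfl

theorem sandwich_comp_sandwich (A B : Matrix l m ℂ) (A' B' : Matrix m n ℂ) :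
    sandwich A B ∘ₗ sandwich A' B' = sandwich (A * A') (B * B') := by
  ext1 ρ
  simp only [LinearMap.comp_apply, sandwich_apply, conjTranspose_mul, Matrix.mul_assoc]

theorem sandwich_add_left (A A' B : Matrix m n ℂ) :
    sandwich (A + A') B = sandwich A B + sandwich A' B := by
  ext1 ρ
  simp only [LinearMap.add_apply, sandwich_apply, Matrix.add_mul]

theorem sandwich_add_right (A B B' : Matrix m n ℂ) :
    sandwich A (B + B') = sandwich A B + sandwich A B' := by
  ext1 ρ
  simp only [LinearMap.add_apply, sandwich_apply, Matrix.mul_add, conjTranspose_add]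

theorem sandwich_zero : sandwich (0 : Matrix m n ℂ) 0 = 0 := by
  ext1 ρ
  simp [sandwich_apply]

theorem sandwich_one [DecidableEq n] : sandwich (1 : Matrix n n ℂ) 1 = LinearMap.id := by
  ext1 ρ
  simp [sandwich_apply]

theorem trace_sandwich_self (A : Matrix m n ℂ) (ρ : Matrix n n ℂ) :
    (sandwich A A ρ).trace = (Aᴴ * A * ρ).trace := by
  rw [sandwich_apply, trace_mul_comm, ← Matrix.mul_assoc]

theorem ampliate_sandwich (A B : Matrix m n ℂ) (k : ℕ) (ρ : Matrix (n × Fin k) (n × Fin k) ℂ) :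
    ampliate (sandwich A B) k ρ =
      kroneckerMap (· * ·) A (1 : Matrix (Fin k) (Fin k) ℂ) * ρ *
        (kroneckerMap (· * ·) B (1 : Matrix (Fin k) (Fin k) ℂ))ᴴ := by
  ext ⟨i, x⟩ ⟨j, y⟩
  simp only [ampliate, sandwich_apply, of_apply, mul_apply, conjTranspose_apply,
    kroneckerMap_apply, Fintype.sum_prod_type, one_apply, mul_ite, ite_mul, mul_one, mul_zero,
    zero_mul, Finset.sum_ite_eq, Finset.mem_univ, if_true, star_zero, apply_ite star]

theorem isCompletelyPositive_sandwich_self (A : Matrix m n ℂ) :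
    IsCompletelyPositive (sandwich A A) := fun k ρ hρ => by
  rw [ampliate_sandwich]
  exact hρ.mul_mul_conjTranspose_same _

theorem isQuantumOperation_sandwich_self [DecidableEq n] {A : Matrix m n ℂ} (hA : Aᴴ * A ≤ 1) :
    IsQuantumOperation (sandwich A A) := by
  refine ⟨isCompletelyPositive_sandwich_self A, fun ρ hρ => ?_⟩
  obtain ⟨B, hB⟩ := CStarAlgebra.nonneg_iff_eq_star_mul_self.1 (sub_nonneg.2 hA)
  have h : 0 ≤ ((1 - Aᴴ * A) * ρ).trace := by
    rw [hB, star_eq_conjTranspose, ← trace_sandwich_self]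
    exact (hρ.mul_mul_conjTranspose_same B).trace_nonneg
  rwa [Matrix.sub_mul, Matrix.one_mul, trace_sub, sub_nonneg, ← trace_sandwich_self] at h

end Operations

section VacuumExtension

variable {l m n : Type*} [Fintype l] [Fintype m] [Fintype n]

/-- The vacuum-extended operation with the single Kraus operator `M` of vacuum amplitude one. -/
def VPair.pure (M : Matrix m n ℂ) : VPair n m := (sandwich M M, M)

theorem VPair.pure_comp_pure (N : Matrix l m ℂ) (M : Matrix m n ℂ) :
    (VPair.pure N).comp (VPair.pure M) = VPair.pure (N * M) := by
  simp only [VPair.pure, VPair.comp, sandwich_comp_sandwich]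

theorem VPair.pure_one [DecidableEq n] :
    VPair.pure (1 : Matrix n n ℂ) = (LinearMap.id, 1) := by
  rw [VPair.pure, sandwich_one]

omit [Fintype m] in
theorem VPair.comp_pure_one [DecidableEq n] (p : VPair n m) :
    p.comp (VPair.pure (1 : Matrix n n ℂ)) = p := by
  rw [VPair.pure_one, VPair.comp, LinearMap.comp_id, Matrix.mul_one]

/-- The inclusion of `ℋ` into `ℋ ⊕ Vac`. -/
def vacInl (n : Type*) [DecidableEq n] : Matrix (n ⊕ Unit) n ℂ := fromRows 1 0

theorem vacInl_mul_mul_conjTranspose [DecidableEq n] (ρ : Matrix n n ℂ) :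
    vacInl n * ρ * (vacInl n)ᴴ = fromBlocks ρ 0 0 0 := by
  ext (i | i) (j | j) <;>
  simp [vacInl, conjTranspose_fromRows_eq_fromCols_conjTranspose, fromRows_mul, mul_fromCols]

theorem conjTranspose_vacInl_mul_mul [DecidableEq n] (ρ : Matrix (n ⊕ Unit) (n ⊕ Unit) ℂ) :
    (vacInl n)ᴴ * ρ * vacInl n = ρ.toBlocks₁₁ := by
  rw [vacInl, conjTranspose_fromRows_eq_fromCols_conjTranspose, ← fromBlocks_toBlocks ρ,
    fromCols_mul_fromBlocks, fromCols_mul_fromRows]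
  simp

theorem vacExt_pure (M : Matrix m n ℂ) :
    vacExt (VPair.pure M) = sandwich (fromBlocks M 0 0 1) (fromBlocks M 0 0 1) := by
  ext1 ρ
  rw [sandwich_apply]
  nth_rw 2 [← fromBlocks_toBlocks ρ]
  simp [fromBlocks_conjTranspose, fromBlocks_multiply, vacExt, VPair.pure, sandwich_apply]

theorem VPair.pure_mem_vacOps [DecidableEq n] {M : Matrix m n ℂ} (hM : Mᴴ * M ≤ 1) :
    VPair.pure M ∈ vacOps n m := by
  refine ⟨isQuantumOperation_sandwich_self hM, ?_⟩
  rw [vacExt_pure]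
  refine isQuantumOperation_sandwich_self (le_iff.2 ?_)
  let N : Matrix (m ⊕ Unit) (n ⊕ Unit) ℂ := fromBlocks M 0 0 1
  have key : 1 - Nᴴ * N = fromBlocks (1 - Mᴴ * M) 0 0 0 := by
    rw [fromBlocks_conjTranspose, fromBlocks_multiply, ← fromBlocks_one, sub_eq_add_neg,
      fromBlocks_neg, fromBlocks_add]
    simp [sub_eq_add_neg]
  rw [key, ← vacInl_mul_mul_conjTranspose]
  exact (le_iff.1 hM).mul_mul_conjTranspose_same _

omit [Fintype m] in
theorem vacExt_injective : Function.Injective (vacExt (n := n) (m := m)) := fun p p' h => by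
  classical
  refine Prod.ext (LinearMap.ext fun ρ => ?_) (Matrix.ext fun i j => ?_)
  · have h₁₁ := congrArg toBlocks₁₁ (LinearMap.congr_fun h (fromBlocks ρ 0 0 0))
    simpa [vacExt] using h₁₁
  · have h₁₂ := congrArg toBlocks₁₂ (LinearMap.congr_fun h (fromBlocks 0 (single j () 1) 0 0))
    simpa [vacExt, mul_apply, single_apply] using congrFun (congrFun h₁₂ i) ()

end VacuumExtension

section LoewnerOrder

variable {m n : Type*} [Fintype m] [Fintype n]

theorem LoewnerLE.apply_le {C D : Matrix n n ℂ →ₗ[ℂ] Matrix m m ℂ} (h : LoewnerLE C D)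
    {ρ : Matrix n n ℂ} (hρ : IsDensity ρ) : C ρ ≤ D ρ := by
  have hd : IsDensity (ρ.submatrix Prod.fst Prod.fst : Matrix (n × Fin 1) (n × Fin 1) ℂ) := by
    refine ⟨hρ.1.submatrix _, ?_⟩
    simpa [trace, Fintype.sum_prod_type] using hρ.2
  exact le_iff.2 ((h 1 _ hd).submatrix fun i : m => (i, (0 : Fin 1)))

theorem exists_ne_zero_isDensity_smul {ρ : Matrix n n ℂ} (hρ : ρ.PosSemidef) :
    ∃ t : ℂ, t ≠ 0 ∧ IsDensity (t • ρ) := by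
  have h : 0 < 1 + ρ.trace := add_pos_of_pos_of_nonneg one_pos hρ.trace_nonneg
  refine ⟨(1 + ρ.trace)⁻¹, inv_ne_zero h.ne', hρ.smul (inv_nonneg.2 h.le), ?_⟩
  rw [trace_smul, smul_eq_mul]
  calc (1 + ρ.trace)⁻¹ * ρ.trace ≤ (1 + ρ.trace)⁻¹ * (1 + ρ.trace) := by
        exact mul_le_mul_of_nonneg_left (le_add_of_nonneg_left zero_le_one) (inv_nonneg.2 h.le)
    _ = 1 := inv_mul_cancel₀ h.ne'

theorem LoewnerLE.antisymm {C D : Matrix n n ℂ →ₗ[ℂ] Matrix m m ℂ} (h : LoewnerLE C D)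
    (h' : LoewnerLE D C) : C = D := by
  classical
  refine LinearMap.ext_on CStarAlgebra.span_nonneg fun ρ hρ => ?_
  obtain ⟨t, ht, htρ⟩ := exists_ne_zero_isDensity_smul (nonneg_iff_posSemidef.1 hρ)
  have key : t • C ρ = t • D ρ := by
    rw [← map_smul, ← map_smul]
    exact le_antisymm (h.apply_le htρ) (h'.apply_le htρ)
  exact smul_right_injective _ ht key

theorem VPair.LE.antisymm {p p' : VPair n m} (h : VPair.LE p p') (h' : VPair.LE p' p) : p = p' :=
  vacExt_injective (LoewnerLE.antisymm h h')

theorem IsLeastFixedPoint.lfp_eq {Φ : VPair n m → VPair n m} {p : VPair n m}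
    (h : IsLeastFixedPoint Φ p) : lfp Φ = p := by
  have hex : ∃ p, IsLeastFixedPoint Φ p := ⟨p, h⟩
  have h' := hex.choose_spec
  rw [lfp, dif_pos hex]
  exact VPair.LE.antisymm (h'.2 p h.1.1 h.1.2) (h.2 _ h'.1.1 h'.1.2)

theorem VPair.le_add_fst (p : VPair n m) {D : Matrix n n ℂ →ₗ[ℂ] Matrix m m ℂ}
    (hD : IsCompletelyPositive D) : VPair.LE p (p.1 + D, p.2) := fun k ρ hρ => by
  classical
  have key : vacExt (p.1 + D, p.2) - vacExt p =
      sandwich (vacInl m) (vacInl m) ∘ₗ D ∘ₗ sandwich (vacInl n)ᴴ (vacInl n)ᴴ := by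
    ext1 ρ
    simp only [LinearMap.comp_apply, sandwich_apply, conjTranspose_conjTranspose,
      vacInl_mul_mul_conjTranspose, conjTranspose_vacInl_mul_mul]
    simp [vacExt, sub_eq_iff_eq_add, fromBlocks_add, add_comm]
  change (ampliate (vacExt (p.1 + D, p.2) - vacExt p) k ρ).PosSemidef
  rw [key]
  exact (isCompletelyPositive_sandwich_self _).comp
    (hD.comp (isCompletelyPositive_sandwich_self _)) k ρ hρ.1

end LoewnerOrder

section ChoiMatrix

variable {m n : Type*} [DecidableEq n]

/-- The Choi matrix of a linear map between matrix algebras. The input index comes first, as in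
`Matrix.vec`, so that `choi (sandwich A A)` is the rank-one matrix of `vec A`. -/
def choi : (Matrix n n ℂ →ₗ[ℂ] Matrix m m ℂ) →ₗ[ℂ] Matrix (n × m) (n × m) ℂ where
  toFun C := of fun p p' => C (single p.1 p'.1 1) p.2 p'.2
  map_add' _ _ := rfl
  map_smul' _ _ := rfl

theorem choi_apply (C : Matrix n n ℂ →ₗ[ℂ] Matrix m m ℂ) (p p' : n × m) :
    choi C p p' = C (single p.1 p'.1 1) p.2 p'.2 :=
  rfl

variable [Fintype n]

omit [Fintype n] in
theorem choi_injective [Finite n] : Function.Injective (choi (m := m) (n := n)) := fun _ _ h =>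
  Matrix.ext_linearMap ℂ fun a b => LinearMap.ext_ring <| Matrix.ext fun i j =>
    congrFun (congrFun h (a, i)) (b, j)

variable [Fintype m]

theorem choi_sandwich (A B : Matrix m n ℂ) :
    choi (sandwich A B) = vecMulVec (vec A) (star (vec B)) := by
  ext ⟨a, i⟩ ⟨b, j⟩
  rw [choi_apply, sandwich_apply, single_eq_single_vecMulVec_single, mul_vecMulVec, vecMulVec_mul]
  simp [vecMulVec_apply, vec]

theorem IsCompletelyPositive.posSemidef_choi {C : Matrix n n ℂ →ₗ[ℂ] Matrix m m ℂ}
    (hC : IsCompletelyPositive C) : (choi C).PosSemidef := by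
  let e := Fintype.equivFin n
  let ω : n × Fin (Fintype.card n) → ℂ := fun p => if e p.1 = p.2 then 1 else 0
  have hω (a b : n) : (of fun c d => vecMulVec ω (star ω) (c, e a) (d, e b)) = single a b 1 := by
    ext c d
    by_cases hc : a = c <;> by_cases hd : b = d <;>
      simp [vecMulVec_apply, ω, hc, hd, eq_comm]
  have key : choi C = (ampliate C _ (vecMulVec ω (star ω))).submatrix
      (fun p => (p.2, e p.1)) (fun p => (p.2, e p.1)) := by
    ext p p'
    rw [submatrix_apply, ampliate, of_apply, hω, choi_apply]
  exact key ▸ (hC _ _ (posSemidef_vecMulVec_self_star ω)).submatrix _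

theorem exists_kraus_of_posSemidef_choi {C : Matrix n n ℂ →ₗ[ℂ] Matrix m m ℂ}
    (hC : (choi C).PosSemidef) :
    ∃ (r : ℕ) (K : Fin r → Matrix m n ℂ), C = ∑ i, sandwich (K i) (K i) := by
  obtain ⟨r, v, hv⟩ := posSemidef_iff_eq_sum_vecMulVec.1 hC
  choose K hK using fun i => vec_bijective.2 (v i)
  refine ⟨r, K, choi_injective ?_⟩
  simp only [hv, map_sum, choi_sandwich, hK]

/-- The basis vectors of `(ℋ ⊕ Vac) ⊗ (ℋ' ⊕ Vac)` that lie in `ℋ ⊗ ℋ'` or in `Vac ⊗ Vac`. The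
Choi matrix of a vacuum extension is supported on them. -/
def vacIndex (n m : Type*) : (n × m) ⊕ Unit → (n ⊕ Unit) × (m ⊕ Unit) :=
  Sum.elim (Prod.map .inl .inl) fun _ => (.inr (), .inr ())

omit [Fintype m] in
theorem choi_vacExt_submatrix (C : Matrix n n ℂ →ₗ[ℂ] Matrix m m ℂ) (F : Matrix m n ℂ) :
    (choi (vacExt (C, F))).submatrix (vacIndex n m) (vacIndex n m) =
      fromBlocks (choi C) (replicateCol Unit (vec F)) (replicateCol Unit (vec F))ᴴ 1 := by
  have h₁₁ (a b : n) : (single (Sum.inl a) (Sum.inl b) 1 :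
      Matrix (n ⊕ Unit) (n ⊕ Unit) ℂ).toBlocks₁₁ = single a b 1 := by
    ext
    simp [toBlocks₁₁, single_apply]
  ext (⟨a, i⟩ | _) (⟨b, j⟩ | _) <;> simp only [submatrix_apply, choi_apply, vacIndex, vacExt]
  · simp [h₁₁, choi_apply]
  all_goals simp [mul_apply, toBlocks₁₂, toBlocks₂₁, toBlocks₂₂, single_apply, vec]

/-- The vacuum block turns positivity of the vacuum extension into a Schur complement. -/
theorem posSemidef_choi_sub_sandwich {C : Matrix n n ℂ →ₗ[ℂ] Matrix m m ℂ} {F : Matrix m n ℂ}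
    (h : IsCompletelyPositive (vacExt (C, F))) : (choi (C - sandwich F F)).PosSemidef := by
  have hblock := h.posSemidef_choi.submatrix (vacIndex n m)
  let _ : Invertible (1 : Matrix Unit Unit ℂ) := invertibleOne
  rw [choi_vacExt_submatrix C F, PosDef.one.fromBlocks₂₂, inv_one, Matrix.mul_one] at hblock
  rwa [map_sub, choi_sandwich, vecMulVec_eq Unit]

omit [DecidableEq n] in
theorem exists_kraus_of_mem_vacOps {C : Matrix n n ℂ →ₗ[ℂ] Matrix m m ℂ} {F : Matrix m n ℂ}
    (h : (C, F) ∈ vacOps n m) :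
    ∃ (r : ℕ) (K : Fin r → Matrix m n ℂ), C = sandwich F F + ∑ i, sandwich (K i) (K i) := by
  classical
  obtain ⟨r, K, hK⟩ :=
    exists_kraus_of_posSemidef_choi (posSemidef_choi_sub_sandwich h.2.completelyPositive)
  exact ⟨r, K, sub_eq_iff_eq_add'.1 hK⟩

end ChoiMatrix

section TraceNonincreasing

variable {m n : Type*} [Fintype m] [Fintype n] [DecidableEq n]

theorem le_one_of_trace_mul_le {A : Matrix n n ℂ} (hA : A.IsHermitian)
    (h : ∀ ρ : Matrix n n ℂ, ρ.PosSemidef → (A * ρ).trace ≤ ρ.trace) : A ≤ 1 := by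
  refine le_iff.2 (.of_dotProduct_mulVec_nonneg (isHermitian_one.sub hA) fun v => ?_)
  have hv := h _ (posSemidef_vecMulVec_self_star v)
  rw [mul_vecMulVec, trace_vecMulVec, trace_vecMulVec] at hv
  rwa [sub_mulVec, one_mulVec, dotProduct_sub, sub_nonneg, dotProduct_comm,
    dotProduct_comm (star v)]

theorem kraus_sum_le_one {ι : Type*} [Fintype ι] {F : Matrix m n ℂ} {K : ι → Matrix m n ℂ}
    (h : IsQuantumOperation (sandwich F F + ∑ i, sandwich (K i) (K i))) :
    Fᴴ * F + ∑ i, (K i)ᴴ * K i ≤ 1 := by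
  refine le_one_of_trace_mul_le ?_ fun ρ hρ => ?_
  · simp [IsHermitian, conjTranspose_sum]
  · simpa only [LinearMap.add_apply, LinearMap.sum_apply, trace_add, trace_sum,
      trace_sandwich_self, Matrix.add_mul, Matrix.sum_mul] using h.trace_le ρ hρ

end TraceNonincreasing

theorem conjTranspose_mul_self_of_isometry {R l m n : Type*} [Semiring R] [StarRing R]
    [Fintype l] [Fintype m] [DecidableEq m] {J : Matrix l m R} (hJ : Jᴴ * J = 1)
    (M : Matrix m n R) : (J * M)ᴴ * (J * M) = Mᴴ * M := by
  rw [conjTranspose_mul, Matrix.mul_assoc, ← Matrix.mul_assoc Jᴴ, hJ, Matrix.one_mul]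

section QubitOperators

variable {X : Type*} [DecidableEq X] {q : X} {Γ : Finset X}

/-- A basis vector of `ℋ_{q,Γ}` is a bit for `q` together with a basis vector of `ℋ_Γ`. -/
def Conf.consEquiv (hq : q ∉ Γ) : Fin 2 × Conf Γ ≃ Conf (insert q Γ) where
  toFun p x := if h : x.1 ∈ Γ then p.2 ⟨x.1, h⟩ else p.1
  invFun b := (b ⟨q, Finset.mem_insert_self q Γ⟩, fun x => b ⟨x.1, Finset.mem_insert_of_mem x.2⟩)
  left_inv p := by ext <;> simp [hq]
  right_inv b := funext fun ⟨x, hx⟩ => by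
    by_cases h : x ∈ Γ
    · simp [h]
    · obtain rfl := (Finset.mem_insert.1 hx).resolve_right h
      simp [h]

theorem ket_eq_submatrix_one (hq : q ∉ Γ) (k : Fin 2) :
    ket q Γ k = (1 : Matrix (Fin 2 × Conf Γ) _ ℂ).submatrix (Conf.consEquiv hq).symm (k, ·) := by
  ext b a
  simp only [ket, submatrix_apply, one_apply, Prod.ext_iff, funext_iff]
  rfl

theorem bra_mul_ket (hq : q ∉ Γ) (k l : Fin 2) :
    bra q Γ k * ket q Γ l = if k = l then 1 else 0 := by
  rw [bra, ket_eq_submatrix_one hq, ket_eq_submatrix_one hq, conjTranspose_submatrix,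
    submatrix_mul_equiv, conjTranspose_one, Matrix.one_mul]
  ext a b
  by_cases h : k = l <;> simp [h, one_apply]

theorem sum_ket_mul_bra (hq : q ∉ Γ) : ∑ k, ket q Γ k * bra q Γ k = 1 := by
  rw [← submatrix_one_equiv (Conf.consEquiv hq).symm]
  ext b b'
  simp only [bra, ket_eq_submatrix_one hq, Matrix.sum_apply, mul_apply, conjTranspose_apply,
    submatrix_apply]
  rw [← Fintype.sum_prod_type' fun k a => (1 : Matrix (Fin 2 × Conf Γ) _ ℂ) _ (k, a) * star _]
  simp [one_apply]

theorem ext_mul_ket {n : Type*} (hq : q ∉ Γ) {A B : Matrix n (Conf (insert q Γ)) ℂ}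
    (h : ∀ k, A * ket q Γ k = B * ket q Γ k) : A = B := by
  rw [← Matrix.mul_one A, ← Matrix.mul_one B, ← sum_ket_mul_bra hq, Matrix.mul_sum, Matrix.mul_sum]
  simp only [← Matrix.mul_assoc, h]

theorem ket_conjTranspose_mul_self (hq : q ∉ Γ) (k : Fin 2) :
    (ket q Γ k)ᴴ * ket q Γ k = 1 := by
  rw [← bra, bra_mul_ket hq, if_pos rfl]

theorem bra_mul_ket_mul {m : Type*} (hq : q ∉ Γ) (k l : Fin 2) (A : Matrix (Conf Γ) m ℂ) :
    bra q Γ k * (ket q Γ l * A) = if k = l then A else 0 := by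
  rw [← Matrix.mul_assoc, bra_mul_ket hq]
  split_ifs <;> simp

theorem exists_bra_mul_eq {m : Type*} (hq : q ∉ Γ) (A B : Matrix (Conf Γ) m ℂ) :
    ∃ V : Matrix (Conf (insert q Γ)) m ℂ,
      Vᴴ * V = Aᴴ * A + Bᴴ * B ∧ bra q Γ 0 * V = A ∧ bra q Γ 1 * V = B := by
  have h₀ : bra q Γ 0 * (ket q Γ 0 * A + ket q Γ 1 * B) = A := by
    simp [Matrix.mul_add, bra_mul_ket_mul hq]
  have h₁ : bra q Γ 1 * (ket q Γ 0 * A + ket q Γ 1 * B) = B := by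
    simp [Matrix.mul_add, bra_mul_ket_mul hq]
  refine ⟨_, ?_, h₀, h₁⟩
  rw [conjTranspose_add, conjTranspose_mul, conjTranspose_mul, ← bra, ← bra, Matrix.add_mul,
    Matrix.mul_assoc, Matrix.mul_assoc, h₀, h₁]

end QubitOperators

section Projections

variable {X : Type*} [DecidableEq X] {q : X} {Γ : Finset X}

theorem proj_mul_proj (hq : q ∈ Γ) (k l : Fin 2) :
    proj hq k * proj hq l = if k = l then proj hq k else 0 := by
  rw [proj, proj, diagonal_mul_diagonal]
  split_ifs with h
  · subst h
    simp
  · refine diagonal_eq_zero.2 (funext fun b => ?_)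
    by_cases hb : b ⟨q, hq⟩ = k <;> simp [hb, h]

theorem isStarProjection_proj (hq : q ∈ Γ) (k : Fin 2) : IsStarProjection (proj hq k) where
  isIdempotentElem := by rw [IsIdempotentElem, proj_mul_proj, if_pos rfl]
  isSelfAdjoint := by
    rw [isSelfAdjoint_iff, star_eq_conjTranspose, proj, diagonal_conjTranspose]
    congr 1
    ext1 b
    simp [apply_ite star]

theorem proj_insert (hq : q ∉ Γ) (k : Fin 2) :
    proj (Finset.mem_insert_self q Γ) k = ket q Γ k * bra q Γ k := by
  refine ext_mul_ket hq fun l => ?_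
  rw [Matrix.mul_assoc, bra_mul_ket hq]
  ext b a
  simp only [proj, diagonal_mul, ket]
  split_ifs <;> simp_all [ket]

/-- On the outcome `1` the loop starts over in the same branch, so that branch contributes nothing
to the least fixed point. -/
theorem isLeastFixedPoint_pure_proj (hq : q ∈ Γ) :
    IsLeastFixedPoint (fun p : VPair (Conf Γ) (Conf Γ) =>
      measOp hq (LinearMap.id, 1) (p.comp (LinearMap.id, 1))) (VPair.pure (proj hq 0)) := by
  have hΦ (p : VPair (Conf Γ) (Conf Γ)) : measOp hq (LinearMap.id, 1) (p.comp (LinearMap.id, 1)) =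
      (sandwich (proj hq 0) (proj hq 0) + p.1 ∘ₗ sandwich (proj hq 1) (proj hq 1), proj hq 0) := by
    rw [← VPair.pure_one, VPair.comp_pure_one, VPair.pure_one, measOp, LinearMap.id_comp,
      Matrix.one_mul]
  have hP : (proj hq 0)ᴴ * proj hq 0 ≤ 1 := by
    rw [← star_eq_conjTranspose, (isStarProjection_proj hq 0).isSelfAdjoint.star_eq,
      (isStarProjection_proj hq 0).isIdempotentElem.eq]
    exact (isStarProjection_proj hq 0).le_one
  refine ⟨⟨VPair.pure_mem_vacOps hP, ?_⟩, fun p hp h => ?_⟩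
  · dsimp only
    rw [hΦ, VPair.pure, sandwich_comp_sandwich, proj_mul_proj, if_neg zero_ne_one, sandwich_zero,
      add_zero]
  · dsimp only at h
    rw [← h, hΦ]
    exact VPair.le_add_fst (VPair.pure (proj hq 0))
      (IsCompletelyPositive.comp hp.1.completelyPositive (isCompletelyPositive_sandwich_self _))

end Projections

section Gates

variable {X : Type*} [DecidableEq X] {q : X} {Γ : Finset X}

theorem gateAt_mul_ket (hq : q ∉ Γ) (U : Matrix (Fin 2) (Fin 2) ℂ) (l : Fin 2) :
    gateAt (Finset.mem_insert_self q Γ) U * ket q Γ l = ∑ k, U k l • ket q Γ k := by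
  ext b a
  obtain ⟨⟨k, a'⟩, rfl⟩ := (Conf.consEquiv hq).surjective b
  have hR : (∑ k, U k l • ket q Γ k) (Conf.consEquiv hq (k, a')) a =
      if a' = a then U k l else 0 := by
    simp only [ket_eq_submatrix_one hq, Matrix.sum_apply, Matrix.smul_apply, submatrix_apply,
      Equiv.symm_apply_apply, one_apply, Prod.mk.injEq, ite_and, smul_eq_mul, mul_ite, mul_one,
      mul_zero, Finset.sum_ite_eq, Finset.mem_univ, if_true]
  have hL : (gateAt (Finset.mem_insert_self q Γ) U * ket q Γ l) (Conf.consEquiv hq (k, a')) a =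
      gateAt (Finset.mem_insert_self q Γ) U (Conf.consEquiv hq (k, a'))
        (Conf.consEquiv hq (l, a)) := by
    simp [ket_eq_submatrix_one hq, mul_apply, one_apply, Equiv.symm_apply_eq]
  have hiff : (∀ x : {x // x ∈ insert q Γ}, x.1 ≠ q →
      Conf.consEquiv hq (k, a') x = Conf.consEquiv hq (l, a) x) ↔ a' = a := by
    refine ⟨fun h => funext fun x => ?_, ?_⟩
    · have hx := h ⟨x.1, Finset.mem_insert_of_mem x.2⟩ (ne_of_mem_of_not_mem x.2 hq)
      simpa [Conf.consEquiv] using hx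
    · rintro rfl ⟨x, hx⟩ hxq
      simp [Conf.consEquiv, (Finset.mem_insert.1 hx).resolve_left hxq]
  rw [hL, hR, gateAt]
  simp only [hiff]
  simp [Conf.consEquiv, hq]

theorem gateAt_conjTranspose (hq : q ∈ Γ) (U : Matrix (Fin 2) (Fin 2) ℂ) :
    (gateAt hq U)ᴴ = gateAt hq Uᴴ := by
  ext b b'
  simp only [gateAt, conjTranspose_apply, apply_ite star, star_zero]
  exact if_congr (forall_congr' fun x => by rw [eq_comm]) rfl rfl

theorem gateAt_mul (hq : q ∈ Γ) (U V : Matrix (Fin 2) (Fin 2) ℂ) :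
    gateAt hq U * gateAt hq V = gateAt hq (U * V) := by
  obtain ⟨Γ, hΓ, rfl⟩ : ∃ Γ', q ∉ Γ' ∧ insert q Γ' = Γ :=
    ⟨Γ.erase q, Finset.notMem_erase q Γ, Finset.insert_erase hq⟩
  refine ext_mul_ket hΓ fun l => ?_
  simp only [Matrix.mul_assoc, gateAt_mul_ket hΓ, Fin.sum_univ_two, Matrix.mul_add, Matrix.mul_smul,
    mul_apply]
  module

theorem gateAt_one (hq : q ∈ Γ) : gateAt hq 1 = 1 := by
  obtain ⟨Γ, hΓ, rfl⟩ : ∃ Γ', q ∉ Γ' ∧ insert q Γ' = Γ :=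
    ⟨Γ.erase q, Finset.notMem_erase q Γ, Finset.insert_erase hq⟩
  refine ext_mul_ket hΓ fun l => ?_
  simp [gateAt_mul_ket hΓ, one_apply]

end Gates

section Multiplexers

variable {X : Type*} [DecidableEq X] {q : X} {Γ Γ' Γ'' : Finset X}

/-- The operator `|0⟩⟨0|_q ⊗ M₀ + |1⟩⟨1|_q ⊗ M₁`, which applies `M₀` or `M₁` depending on the
control qubit `q`. -/
noncomputable def multiplexer (q : X) (M : Fin 2 → Matrix (Conf Γ') (Conf Γ) ℂ) :
    Matrix (Conf (insert q Γ')) (Conf (insert q Γ)) ℂ :=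
  ∑ k, controlled q k (M k)

theorem multiplexer_mul_ket (hq : q ∉ Γ) (M : Fin 2 → Matrix (Conf Γ') (Conf Γ) ℂ) (k : Fin 2) :
    multiplexer q M * ket q Γ k = ket q Γ' k * M k := by
  simp only [multiplexer, controlled, Matrix.sum_mul, Matrix.mul_assoc, bra_mul_ket hq]
  rw [Fintype.sum_eq_single k fun l hl => by rw [if_neg hl, Matrix.mul_zero, Matrix.mul_zero],
    if_pos rfl, Matrix.mul_one]

theorem multiplexer_one (hq : q ∉ Γ) :
    multiplexer q (fun _ => (1 : Matrix (Conf Γ) (Conf Γ) ℂ)) = 1 :=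
  ext_mul_ket hq fun k => by rw [multiplexer_mul_ket hq, Matrix.mul_one, Matrix.one_mul]

theorem multiplexer_mul (hq : q ∉ Γ) (hq' : q ∉ Γ') (N : Fin 2 → Matrix (Conf Γ'') (Conf Γ') ℂ)
    (M : Fin 2 → Matrix (Conf Γ') (Conf Γ) ℂ) :
    multiplexer q N * multiplexer q M = multiplexer q fun k => N k * M k :=
  ext_mul_ket hq fun k => by
    rw [Matrix.mul_assoc, multiplexer_mul_ket hq, ← Matrix.mul_assoc, multiplexer_mul_ket hq',
      multiplexer_mul_ket hq, Matrix.mul_assoc]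

theorem multiplexer_conjTranspose (q : X) (M : Fin 2 → Matrix (Conf Γ') (Conf Γ) ℂ) :
    (multiplexer q M)ᴴ = multiplexer q fun k => (M k)ᴴ := by
  simp only [multiplexer, controlled, bra, conjTranspose_sum, conjTranspose_mul,
    conjTranspose_conjTranspose, Matrix.mul_assoc]

theorem qcaseOp_pure (q : X) (M : Fin 2 → Matrix (Conf Γ') (Conf Γ) ℂ) :
    qcaseOp q (VPair.pure (M 0)) (VPair.pure (M 1)) = VPair.pure (multiplexer q M) := by
  simp only [qcaseOp, VPair.pure, multiplexer, Fin.sum_univ_two, sandwich_comp_sandwich,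
    sandwich_add_left, sandwich_add_right, controlled, ← Matrix.mul_assoc]
  congr 1
  abel

end Multiplexers

section Householder

variable {𝕜 n : Type*} [RCLike 𝕜] [Fintype n] [DecidableEq n]

/-- The generalized Householder matrix `1 - a w w†`, where `a` may be any scalar and `w` need not
be normalized. -/
def householder (a : 𝕜) (w : n → 𝕜) : Matrix n n 𝕜 := 1 - a • vecMulVec w (star w)

theorem householder_mulVec (a : 𝕜) (w x : n → 𝕜) :
    householder a w *ᵥ x = x - (a * (star w ⬝ᵥ x)) • w := by
  rw [householder, sub_mulVec, one_mulVec, smul_mulVec, vecMulVec_mulVec, op_smul_eq_smul,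
    smul_smul]

omit [Fintype n] in
theorem householder_smul (a c : 𝕜) (w : n → 𝕜) :
    householder a (c • w) = householder (a * (c * star c)) w := by
  rw [householder, householder, star_smul, smul_vecMulVec, vecMulVec_smul, smul_smul, smul_smul,
    mul_assoc]

theorem star_mul_householder_mulVec_mul (a : 𝕜) (w : n → 𝕜) {U : Matrix n n 𝕜}
    (hU : U ∈ unitaryGroup n 𝕜) : star U * householder a (U *ᵥ w) * U = householder a w := by
  have hUw : star U *ᵥ U *ᵥ w = w := by
    rw [mulVec_mulVec, mem_unitaryGroup_iff'.1 hU, one_mulVec]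
  have hwU : star (U *ᵥ w) ᵥ* U = star w := by
    rw [star_mulVec, vecMul_vecMul, ← star_eq_conjTranspose, mem_unitaryGroup_iff'.1 hU,
      vecMul_one]
  rw [householder, Matrix.mul_sub, Matrix.sub_mul, Matrix.mul_one, mem_unitaryGroup_iff'.1 hU,
    Matrix.mul_smul, Matrix.smul_mul, mul_vecMulVec, vecMulVec_mul, hUw, hwU, householder]

theorem householder_mem_unitaryGroup {a : 𝕜} {w : n → 𝕜}
    (h : a + star a = star a * a * (star w ⬝ᵥ w)) : householder a w ∈ unitaryGroup n 𝕜 := by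
  rw [mem_unitaryGroup_iff', star_eq_conjTranspose, ← sub_eq_zero]
  calc (householder a w)ᴴ * householder a w - 1
      = (star a * a * (star w ⬝ᵥ w) - (a + star a)) • vecMulVec w (star w) := by
        simp only [householder, conjTranspose_sub, conjTranspose_one, conjTranspose_smul,
          conjTranspose_vecMulVec, star_star, Matrix.mul_sub, Matrix.sub_mul, Matrix.mul_one,
          Matrix.one_mul, Matrix.smul_mul, Matrix.mul_smul, vecMulVec_mul_vecMulVec,
          vecMulVec_smul]
        module
    _ = 0 := by rw [h, sub_self, zero_smul]

variable {u v : n → 𝕜}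

omit [DecidableEq n] in
theorem star_sub_dotProduct_sub (hu : star u ⬝ᵥ u = 1) (hv : star v ⬝ᵥ v = 1) :
    star (u - v) ⬝ᵥ (u - v) = (1 - star v ⬝ᵥ u) + star (1 - star v ⬝ᵥ u) := by
  have huv : star (star v ⬝ᵥ u) = star u ⬝ᵥ v := by rw [star_dotProduct, star_star]
  rw [star_sub u, star_sub, star_one, huv, sub_dotProduct, dotProduct_sub, dotProduct_sub, hu, hv]
  ring

theorem householder_sub_mulVec_left (hu : star u ⬝ᵥ u = 1) (hv : star v ⬝ᵥ v = 1) :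
    householder (1 - star v ⬝ᵥ u)⁻¹ (u - v) *ᵥ u = v := by
  rw [householder_mulVec, star_sub, sub_dotProduct, hu]
  by_cases h : 1 - star v ⬝ᵥ u = 0
  · have huv : u - v = 0 := dotProduct_star_self_eq_zero.1 <| by
      rw [star_sub_dotProduct_sub hu hv, h, star_zero, add_zero]
    rw [huv, smul_zero, sub_zero, sub_eq_zero.1 huv]
  · rw [inv_mul_cancel₀ h, one_smul, sub_sub_cancel]

theorem householder_sub_mulVec_of_dotProduct_eq_zero (a : 𝕜) {x : n → 𝕜} (hu : star u ⬝ᵥ x = 0)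
    (hv : star v ⬝ᵥ x = 0) : householder a (u - v) *ᵥ x = x := by
  rw [householder_mulVec, star_sub, sub_dotProduct, hu, hv, sub_zero, mul_zero, zero_smul, sub_zero]

omit [DecidableEq n] in
theorem householder_coeff_sub (hu : star u ⬝ᵥ u = 1) (hv : star v ⬝ᵥ v = 1) {a : 𝕜}
    (ha : a = (1 - star v ⬝ᵥ u)⁻¹) :
    a + star a = star a * a * (star (u - v) ⬝ᵥ (u - v)) := by
  rw [star_sub_dotProduct_sub hu hv, ha]
  generalize 1 - star v ⬝ᵥ u = s
  by_cases h : s = 0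
  · simp [h]
  · have h' : star s ≠ 0 := star_ne_zero.2 h
    rw [star_inv₀]
    field_simp
    ring

theorem exists_unitary_mulVec_eq_smul_single (i : n) (v : n → 𝕜) :
    ∃ U ∈ unitaryGroup n 𝕜, ∃ c : 𝕜, U *ᵥ v = c • Pi.single i 1 := by
  by_cases hv : v = 0
  · exact ⟨1, one_mem _, 0, by rw [hv, mulVec_zero, zero_smul]⟩
  set r : 𝕜 := ((‖WithLp.toLp 2 v‖ : ℝ) : 𝕜)
  have hr : r ≠ 0 := by simpa [r] using hv
  have hvv : star v ⬝ᵥ v = r * r := by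
    rw [dotProduct_comm, ← sq, ← inner_self_eq_norm_sq_to_K (𝕜 := 𝕜) (WithLp.toLp 2 v)]
    rfl
  have hu : star (r⁻¹ • v) ⬝ᵥ (r⁻¹ • v) = 1 := by
    have hrr : star r = r := RCLike.conj_ofReal _
    rw [star_smul, smul_dotProduct, dotProduct_smul, hvv, star_inv₀, hrr, smul_eq_mul, smul_eq_mul]
    field_simp
  have he : star (Pi.single i 1) ⬝ᵥ (Pi.single i 1 : n → 𝕜) = 1 := by simp
  refine ⟨_, householder_mem_unitaryGroup (householder_coeff_sub hu he rfl), r, ?_⟩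
  nth_rw 3 [← householder_sub_mulVec_left hu he]
  rw [← mulVec_smul, smul_inv_smul₀ hr]

theorem exists_mem_submonoid_mul_eq {m : Type*} [Finite m] [DecidableEq m]
    {S : Submonoid (Matrix n n 𝕜)}
    (hS : ∀ a w, a + star a = star a * a * (star w ⬝ᵥ w) → householder a w ∈ S)
    {A B : Matrix n m 𝕜} (hA : Aᴴ * A = 1) (hB : Bᴴ * B = 1) : ∃ W ∈ S, W * A = B := by
  cases nonempty_fintype m
  have col_dot {C : Matrix n m 𝕜} (hC : Cᴴ * C = 1) (i j : m) :
      star (C.col i) ⬝ᵥ C.col j = if i = j then 1 else 0 := by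
    rw [← one_apply, ← hC]
    rfl
  suffices h : ∀ s : Finset m, ∃ W ∈ S, (W * A)ᴴ * (W * A) = 1 ∧ ∀ i ∈ s, (W * A).col i = B.col i by
    obtain ⟨W, hW, -, hWA⟩ := h Finset.univ
    exact ⟨W, hW, ext_col fun i => hWA i (Finset.mem_univ i)⟩
  intro s
  induction s using Finset.induction_on with
  | empty => exact ⟨1, one_mem S, by rwa [Matrix.one_mul], by simp⟩
  | insert k s hk ih =>
    obtain ⟨W, hW, hWA, hWs⟩ := ih
    have hu : star ((W * A).col k) ⬝ᵥ (W * A).col k = 1 := by rw [col_dot hWA, if_pos rfl]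
    have hv : star (B.col k) ⬝ᵥ B.col k = 1 := by rw [col_dot hB, if_pos rfl]
    have hcoeff := householder_coeff_sub hu hv rfl
    set R := householder (1 - star (B.col k) ⬝ᵥ (W * A).col k)⁻¹ ((W * A).col k - B.col k)
    have hRR : Rᴴ * R = 1 := mem_unitaryGroup_iff'.1 (householder_mem_unitaryGroup hcoeff)
    refine ⟨R * W, mul_mem (hS _ _ hcoeff) hW, ?_, fun i hi => ?_⟩
    · rw [Matrix.mul_assoc R, conjTranspose_mul_self_of_isometry hRR, hWA]
    have hcol : (R * W * A).col i = R *ᵥ (W * A).col i := by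
      rw [Matrix.mul_assoc]
      rfl
    rw [hcol]
    rcases Finset.mem_insert.1 hi with rfl | hi
    · exact householder_sub_mulVec_left hu hv
    · have hki : k ≠ i := fun h => hk (h ▸ hi)
      rw [householder_sub_mulVec_of_dotProduct_eq_zero, hWs i hi]
      · rw [col_dot hWA, if_neg hki]
      · rw [hWs i hi, col_dot hB, if_neg hki]

end Householder

section Circuits

variable {X : Type*} [DecidableEq X] {q : X} {Γ : Finset X}

/-- The operators on `ℋ_Γ` generated by one-qubit gates and multiplexers. Since the branches of a
multiplexer act on the remaining qubits, they form a class of unitaries that is closed under quantum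
control. -/
inductive IsCircuit : (Γ : Finset X) → Matrix (Conf Γ) (Conf Γ) ℂ → Prop
  | one (Γ : Finset X) : IsCircuit Γ 1
  | mul {Γ : Finset X} {M N : Matrix (Conf Γ) (Conf Γ) ℂ} (hM : IsCircuit Γ M)
      (hN : IsCircuit Γ N) : IsCircuit Γ (M * N)
  | gate {q : X} {Γ : Finset X} (hq : q ∈ Γ) {U : Matrix (Fin 2) (Fin 2) ℂ}
      (hU : U ∈ unitaryGroup (Fin 2) ℂ) : IsCircuit Γ (gateAt hq U)
  | multiplexer {q : X} {Γ : Finset X} (hq : q ∉ Γ) {M : Fin 2 → Matrix (Conf Γ) (Conf Γ) ℂ}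
      (hM : ∀ k, IsCircuit Γ (M k)) : IsCircuit (insert q Γ) (multiplexer q M)

theorem IsCircuit.exists_derivation {M : Matrix (Conf Γ) (Conf Γ) ℂ} (h : IsCircuit Γ M) :
    ∃ S, S.vars ⊆ Γ ∧ ∃ d : Derivation Γ S Γ, d.sem = VPair.pure M := by
  induction h with
  | one Γ => exact ⟨.skip, Finset.empty_subset Γ, .skip Γ, VPair.pure_one.symm⟩
  | mul _ _ ihM ihN =>
    obtain ⟨S, hS, d, hd⟩ := ihM
    obtain ⟨T, hT, e, he⟩ := ihN
    refine ⟨.seq T S, Finset.union_subset hT hS, .seq e d, ?_⟩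
    rw [Derivation.sem, hd, he, VPair.pure_comp_pure]
  | @gate q Γ hq U hU =>
    exact ⟨.gate q ⟨U, hU⟩, Finset.singleton_subset_iff.2 hq, .gate q ⟨U, hU⟩ Γ hq, rfl⟩
  | @multiplexer q Γ hq M _ ih =>
    choose S hS d hd using ih
    have hvars := Finset.union_subset (hS 0) (hS 1)
    refine ⟨.qcase q (S 0) (S 1), Finset.insert_subset_insert q hvars,
      .qcase q hq hq (fun h => hq (hvars h)) (d 0) (d 1), ?_⟩
    rw [Derivation.sem, hd, hd, qcaseOp_pure]

theorem IsCircuit.conjTranspose {M : Matrix (Conf Γ) (Conf Γ) ℂ} (h : IsCircuit Γ M) :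
    IsCircuit Γ Mᴴ := by
  induction h with
  | one Γ => rw [conjTranspose_one]; exact .one Γ
  | mul _ _ ihM ihN => rw [conjTranspose_mul]; exact ihN.mul ihM
  | gate hq hU => rw [gateAt_conjTranspose]; exact .gate hq (Unitary.star_mem hU)
  | multiplexer hq _ ih => rw [multiplexer_conjTranspose]; exact .multiplexer hq ih

theorem IsCircuit.mem_unitaryGroup {M : Matrix (Conf Γ) (Conf Γ) ℂ} (h : IsCircuit Γ M) :
    M ∈ unitaryGroup (Conf Γ) ℂ := by
  induction h with
  | one => exact one_mem _
  | mul _ _ ihM ihN => exact mul_mem ihM ihN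
  | gate hq hU =>
    rw [mem_unitaryGroup_iff', star_eq_conjTranspose, gateAt_conjTranspose, gateAt_mul,
      ← star_eq_conjTranspose, mem_unitaryGroup_iff'.1 hU, gateAt_one]
  | multiplexer hq _ ih =>
    rw [mem_unitaryGroup_iff', star_eq_conjTranspose, multiplexer_conjTranspose,
      multiplexer_mul hq hq]
    simp only [← star_eq_conjTranspose, mem_unitaryGroup_iff'.1 (ih _), multiplexer_one hq]

/-- The basis vector `|0…0⟩` of `ℋ_Γ`. -/
noncomputable def zeroVec (Γ : Finset X) : Conf Γ → ℂ := Pi.single 0 1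

theorem ket_mulVec_zeroVec (hq : q ∉ Γ) : ket q Γ 0 *ᵥ zeroVec Γ = zeroVec (insert q Γ) := by
  have h : (Conf.consEquiv hq).symm 0 = (0, 0) := rfl
  ext b
  rw [zeroVec, mulVec_single_one, col_apply, ket_eq_submatrix_one hq, submatrix_apply, zeroVec,
    one_apply, ← h, Pi.single_apply]
  simp only [EmbeddingLike.apply_eq_iff_eq]

theorem gateAt_mulVec_sum_ket (hq : q ∉ Γ) (U : Matrix (Fin 2) (Fin 2) ℂ) (c : Fin 2 → ℂ)
    (x : Conf Γ → ℂ) :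
    gateAt (Finset.mem_insert_self q Γ) U *ᵥ ∑ k, c k • ket q Γ k *ᵥ x =
      ∑ k, (U *ᵥ c) k • ket q Γ k *ᵥ x := by
  simp only [Fin.sum_univ_two, mulVec_add, mulVec_smul, mulVec_mulVec, gateAt_mul_ket hq,
    add_mulVec, smul_mulVec, mulVec, dotProduct]
  module

/-- State preparation, run backwards. -/
theorem exists_isCircuit_mulVec_eq_smul_zeroVec (v : Conf Γ → ℂ) :
    ∃ P, IsCircuit Γ P ∧ ∃ c : ℂ, P *ᵥ v = c • zeroVec Γ := by
  induction Γ using Finset.induction_on with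
  | empty =>
    refine ⟨1, .one ∅, v 0, funext fun i => ?_⟩
    obtain rfl : i = 0 := Subsingleton.elim _ _
    simp [zeroVec]
  | insert q Γ hq ih =>
    choose P hP c hc using fun k => ih (bra q Γ k *ᵥ v)
    obtain ⟨U, hU, d, hd⟩ := exists_unitary_mulVec_eq_smul_single 0 c
    refine ⟨_, (IsCircuit.gate (Finset.mem_insert_self q Γ) hU).mul (.multiplexer hq hP), d, ?_⟩
    have hPv : multiplexer q P *ᵥ v = ∑ k, c k • ket q Γ k *ᵥ zeroVec Γ := by
      simp only [multiplexer, controlled, sum_mulVec, ← mulVec_mulVec, hc, mulVec_smul]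
    rw [← mulVec_mulVec, hPv, gateAt_mulVec_sum_ket hq, hd, Fin.sum_univ_two,
      ← ket_mulVec_zeroVec hq]
    simp

theorem householder_zeroVec_insert (hq : q ∉ Γ) (a : ℂ) :
    householder a (zeroVec (insert q Γ)) = multiplexer q ![householder a (zeroVec Γ), 1] := by
  have h : vecMulVec (zeroVec (insert q Γ)) (star (zeroVec (insert q Γ))) =
      ket q Γ 0 * vecMulVec (zeroVec Γ) (star (zeroVec Γ)) * bra q Γ 0 := by
    rw [← ket_mulVec_zeroVec hq, bra, mul_vecMulVec, vecMulVec_mul, star_mulVec]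
  refine ext_mul_ket hq (Fin.forall_fin_two.2 ⟨?_, ?_⟩) <;>
  simp [householder, h, multiplexer_mul_ket hq, Matrix.sub_mul, Matrix.mul_sub, Matrix.mul_assoc,
    bra_mul_ket hq]

omit [DecidableEq X] in
theorem householder_zeroVec_empty (a : ℂ) :
    householder a (zeroVec (∅ : Finset X)) = (1 - a) • 1 := by
  ext i j
  obtain rfl : i = 0 := Subsingleton.elim _ _
  obtain rfl : j = 0 := Subsingleton.elim _ _
  simp [householder, zeroVec, vecMulVec_apply]

theorem householder_zeroVec_insert_eq_gateAt (hq : q ∉ Γ) {a : ℂ}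
    (h : householder a (zeroVec Γ) = (1 - a) • 1) :
    householder a (zeroVec (insert q Γ)) =
      gateAt (Finset.mem_insert_self q Γ) (householder a (Pi.single 0 1)) := by
  rw [householder_zeroVec_insert hq, h]
  refine ext_mul_ket hq (Fin.forall_fin_two.2 ⟨?_, ?_⟩) <;>
  simp [multiplexer_mul_ket hq, gateAt_mul_ket hq, householder, vecMulVec_apply]

theorem isCircuit_householder_zeroVec {a : ℂ} (ha : a + star a = star a * a) (hΓ : Γ.Nonempty) :
    IsCircuit Γ (householder a (zeroVec Γ)) := by
  induction hΓ using Finset.Nonempty.cons_induction with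
  | singleton q =>
    have h := IsCircuit.gate (Finset.mem_insert_self q ∅)
      (householder_mem_unitaryGroup (w := Pi.single 0 1) (by simpa using ha))
    rwa [← householder_zeroVec_insert_eq_gateAt (Finset.notMem_empty q)
      (householder_zeroVec_empty a)] at h
  | cons q Γ hq _ ih =>
    rw [Finset.cons_eq_insert, householder_zeroVec_insert hq]
    exact .multiplexer hq (Fin.forall_fin_two.2 ⟨ih, .one Γ⟩)

theorem isCircuit_householder (hΓ : Γ.Nonempty) {a : ℂ} {w : Conf Γ → ℂ}
    (h : a + star a = star a * a * (star w ⬝ᵥ w)) : IsCircuit Γ (householder a w) := by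
  obtain ⟨P, hP, c, hc⟩ := exists_isCircuit_mulVec_eq_smul_zeroVec w
  have hPP := hP.mem_unitaryGroup
  have hww : star w ⬝ᵥ w = star c * c := by
    calc star w ⬝ᵥ w = star (P *ᵥ w) ⬝ᵥ (P *ᵥ w) := by
          rw [star_mulVec, ← dotProduct_mulVec, mulVec_mulVec, ← star_eq_conjTranspose,
            mem_unitaryGroup_iff'.1 hPP, one_mulVec]
      _ = star c * c := by simp [hc, zeroVec, mul_comm]
  rw [← star_mul_householder_mulVec_mul a w hPP, hc, householder_smul]
  refine (hP.conjTranspose.mul (isCircuit_householder_zeroVec ?_ hΓ)).mul hP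
  rw [hww] at h
  simp only [star_mul', star_star]
  linear_combination (c * star c) * h

theorem exists_isCircuit_mul_eq (hΓ : Γ.Nonempty) {n : Type*} [Finite n] [DecidableEq n]
    {A B : Matrix (Conf Γ) n ℂ} (hA : Aᴴ * A = 1) (hB : Bᴴ * B = 1) :
    ∃ W, IsCircuit Γ W ∧ W * A = B :=
  let circuits : Submonoid (Matrix (Conf Γ) (Conf Γ) ℂ) :=
    { carrier := {M | IsCircuit Γ M}, one_mem' := .one Γ, mul_mem' := .mul }
  exists_mem_submonoid_mul_eq (S := circuits) (fun _ _ => isCircuit_householder hΓ) hA hB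

end Circuits

section Realizability

variable {X : Type*} [DecidableEq X] {q : X} {Γ Δ Λ : Finset X}

/-- The pair `p` is the interpretation of some program `(Γ; S; Δ)`. -/
def IsRealizable (Γ Δ : Finset X) (p : VPair (Conf Γ) (Conf Δ)) : Prop :=
  ∃ S, ∃ d : Derivation Γ S Δ, d.sem = p

theorem IsRealizable.comp {p : VPair (Conf Γ) (Conf Δ)} {p' : VPair (Conf Δ) (Conf Λ)}
    (h' : IsRealizable Δ Λ p') (h : IsRealizable Γ Δ p) : IsRealizable Γ Λ (p'.comp p) := by
  obtain ⟨S, d, rfl⟩ := h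
  obtain ⟨S', d', rfl⟩ := h'
  exact ⟨.seq S S', .seq d d', rfl⟩

theorem IsRealizable.pure_mul {M : Matrix (Conf Δ) (Conf Γ) ℂ} {N : Matrix (Conf Λ) (Conf Δ) ℂ}
    (hN : IsRealizable Δ Λ (.pure N)) (hM : IsRealizable Γ Δ (.pure M)) :
    IsRealizable Γ Λ (.pure (N * M)) :=
  VPair.pure_comp_pure N M ▸ hN.comp hM

theorem IsCircuit.isRealizable {M : Matrix (Conf Γ) (Conf Γ) ℂ} (h : IsCircuit Γ M) :
    IsRealizable Γ Γ (.pure M) := by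
  obtain ⟨S, -, d, hd⟩ := h.exists_derivation
  exact ⟨S, d, hd⟩

theorem isRealizable_ket (hq : q ∉ Γ) : IsRealizable Γ (insert q Γ) (.pure (ket q Γ 0)) :=
  ⟨.newQbit q, .newQbit q Γ hq, rfl⟩

theorem isRealizable_discard (hq : q ∉ Γ) :
    IsRealizable (insert q Γ) Γ
      (sandwich (bra q Γ 0) (bra q Γ 0) + sandwich (bra q Γ 1) (bra q Γ 1), bra q Γ 0) :=
  ⟨.discard q, .discard q Γ hq, rfl⟩

theorem isRealizable_proj (hq : q ∈ Γ) : IsRealizable Γ Γ (.pure (proj hq 0)) :=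
  ⟨.whileDo q .skip, .whileDo q hq (.skip Γ), (isLeastFixedPoint_pure_proj hq).lfp_eq⟩

theorem isRealizable_bra (hq : q ∉ Γ) : IsRealizable (insert q Γ) Γ (.pure (bra q Γ 0)) := by
  convert (isRealizable_discard hq).comp (isRealizable_proj (Finset.mem_insert_self q Γ)) using 1
  simp [VPair.pure, VPair.comp, LinearMap.add_comp, sandwich_comp_sandwich, proj_insert hq,
    bra_mul_ket_mul hq, sandwich_zero]

theorem exists_isometry_isRealizable (h : Γ ⊆ Λ) :
    ∃ J : Matrix (Conf Λ) (Conf Γ) ℂ, Jᴴ * J = 1 ∧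
      IsRealizable Γ Λ (.pure J) ∧ IsRealizable Λ Γ (.pure Jᴴ) := by
  rw [← Finset.union_eq_left.2 h]
  clear h
  induction Λ using Finset.induction_on with
  | empty =>
    rw [Finset.empty_union]
    exact ⟨1, by simp, (IsCircuit.one Γ).isRealizable, by
      simpa using (IsCircuit.one Γ).isRealizable⟩
  | insert q Λ _ ih =>
    obtain ⟨J, hJ, h, h'⟩ := ih
    rw [Finset.insert_union]
    by_cases hq : q ∈ Λ ∪ Γ
    · rw [Finset.insert_eq_of_mem hq]
      exact ⟨J, hJ, h, h'⟩
    · refine ⟨ket q (Λ ∪ Γ) 0 * J, ?_, (isRealizable_ket hq).pure_mul h, ?_⟩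
      · rw [conjTranspose_mul_self_of_isometry (ket_conjTranspose_mul_self hq 0), hJ]
      · rw [conjTranspose_mul]
        exact h'.pure_mul (isRealizable_bra hq)

variable [Infinite X]

theorem isRealizable_pure {F : Matrix (Conf Δ) (Conf Γ) ℂ} (hF : Fᴴ * F ≤ 1) :
    IsRealizable Γ Δ (.pure F) := by
  obtain ⟨q, hq⟩ := Infinite.exists_notMem_finset (Γ ∪ Δ)
  obtain ⟨A, hA, hA', -⟩ :=
    exists_isometry_isRealizable (Finset.subset_union_left (s₁ := Γ) (s₂ := Δ))
  obtain ⟨B, hB, -, hB'⟩ :=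
    exists_isometry_isRealizable (Finset.subset_union_right (s₁ := Γ) (s₂ := Δ))
  obtain ⟨D, hD⟩ := CStarAlgebra.nonneg_iff_eq_star_mul_self.1 (sub_nonneg.2 hF)
  have hFD : Fᴴ * F + Dᴴ * D = 1 := by
    rw [← star_eq_conjTranspose D, ← hD, add_sub_cancel]
  obtain ⟨V, hV, hVF, -⟩ := exists_bra_mul_eq hq (B * F) (A * D)
  rw [conjTranspose_mul_self_of_isometry hB, conjTranspose_mul_self_of_isometry hA, hFD] at hV
  have hA₀ : (ket q (Γ ∪ Δ) 0 * A)ᴴ * (ket q (Γ ∪ Δ) 0 * A) = 1 := by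
    rw [conjTranspose_mul_self_of_isometry (ket_conjTranspose_mul_self hq 0), hA]
  obtain ⟨W, hW, hWV⟩ := exists_isCircuit_mul_eq (Finset.insert_nonempty q (Γ ∪ Δ)) hA₀ hV
  have h := hB'.pure_mul ((isRealizable_bra hq).pure_mul
    (hW.isRealizable.pure_mul ((isRealizable_ket hq).pure_mul hA')))
  rwa [hWV, hVF, ← Matrix.mul_assoc, hB, Matrix.one_mul] at h

theorem isRealizable_kraus {ι : Type*} (s : Finset ι) {F : Matrix (Conf Δ) (Conf Γ) ℂ}
    {K : ι → Matrix (Conf Δ) (Conf Γ) ℂ} (h : Fᴴ * F + ∑ i ∈ s, (K i)ᴴ * K i ≤ 1) :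
    IsRealizable Γ Δ (sandwich F F + ∑ i ∈ s, sandwich (K i) (K i), F) := by
  classical
  induction s using Finset.induction_on generalizing Δ with
  | empty =>
    rw [Finset.sum_empty, add_zero] at h ⊢
    exact isRealizable_pure h
  | insert j s hj ih =>
    obtain ⟨q, hq⟩ := Infinite.exists_notMem_finset Δ
    obtain ⟨L, hL, hL₀, hL₁⟩ := exists_bra_mul_eq hq F (K j)
    have hLK : Lᴴ * L + ∑ i ∈ s, (ket q Δ 0 * K i)ᴴ * (ket q Δ 0 * K i) ≤ 1 := by
      simpa only [hL, conjTranspose_mul_self_of_isometry (ket_conjTranspose_mul_self hq 0),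
        Finset.sum_insert hj, ← add_assoc] using h
    convert (isRealizable_discard hq).comp (ih hLK) using 1
    refine Prod.ext (LinearMap.ext fun ρ => ?_) hL₀.symm
    simp only [VPair.comp, LinearMap.comp_apply, LinearMap.add_apply, LinearMap.sum_apply, map_add,
      map_sum, Finset.sum_insert hj]
    simp only [← LinearMap.comp_apply, sandwich_comp_sandwich, hL₀, hL₁, bra_mul_ket_mul hq,
      if_true, one_ne_zero, if_false, sandwich_zero, LinearMap.zero_apply, add_zero,
      add_assoc]

end Realizability

end QLang

theorem theorem1_general {X : Type*} [DecidableEq X] [Infinite X] (Γ Δ : Finset X)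
    (C : Matrix (QLang.Conf Γ) (QLang.Conf Γ) ℂ →ₗ[ℂ] Matrix (QLang.Conf Δ) (QLang.Conf Δ) ℂ)
    (F : Matrix (QLang.Conf Δ) (QLang.Conf Γ) ℂ)
    (hCF : (C, F) ∈ QLang.vacOps (QLang.Conf Γ) (QLang.Conf Δ)) :
    ∃ (S : QLang.Stmt X) (h : QLang.IsProgram Γ S Δ), QLang.sem h = (C, F) := by
  obtain ⟨r, K, rfl⟩ := QLang.exists_kraus_of_mem_vacOps hCF
  obtain ⟨S, d, hd⟩ := QLang.isRealizable_kraus Finset.univ (QLang.kraus_sum_le_one hCF.1)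
  exact ⟨S, ⟨d⟩, (QLang.sem_eq ⟨d⟩ d).trans hd⟩

theorem theorem1 {X : Type*} [DecidableEq X] [Countable X] [Infinite X] (Γ Δ : Finset X)
    (C : Matrix (QLang.Conf Γ) (QLang.Conf Γ) ℂ →ₗ[ℂ] Matrix (QLang.Conf Δ) (QLang.Conf Δ) ℂ)
    (F : Matrix (QLang.Conf Δ) (QLang.Conf Γ) ℂ)
    (hCF : (C, F) ∈ QLang.vacOps (QLang.Conf Γ) (QLang.Conf Δ)) :
    ∃ (S : QLang.Stmt X) (h : QLang.IsProgram Γ S Δ), QLang.sem h = (C, F) :=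
  theorem1_general Γ Δ C F hCF
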